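/- Modal formulas are built from variables \(p_0,p_1,\dots\) by \(\bot,\to,\Box\). A normal modal logic is a set of formulas that contains all propositional tautologies and \(\Box(p\to q)\to(\Box p\to\Box q)\) and is closed under modus ponens, necessitation (from \(\varphi\) infer \(\Box\varphi\)) and substitution. Let \(\mathbf{Grz.3}\) be the smallest normal modal logic containing \(\Box p\to p\), \(\Box p\to\Box\Box p\), \(\Box(\Box p\to q)\vee\Box(\Box q\to p)\) and \(\Box(\Box(p\to\Box p)\to p)\to p\). A Kripke frame (a nonempty set with a binary relation) is a \(\mathbf{Grz.3}\)-frame if all formulas of \(\mathbf{Grz.3}\) are valid in it; these are exactly the frames whose relation \(R\) is reflexive, transitive, non-branching (\(aRb\) and \(aRc\) imply \(bRc\) or \(cRb\) or \(b=c\)) and Noetherian (there is no infinite chain \(a_0Ra_1R\cdots\) with \(a_i\neq a_{i+1}\) for all \(i\)). For \(n\ge 1\) let \(\hat F_n\) be a uniformly distributed random element of the finite set of all \(\mathbf{Grz.3}\)-frames with set of states \(\{0,\dots,n-1\}\), and let \[ \mathbf{Grz.3}^{\mathbf{as}}=\Bigl\{\varphi \;:\; \lim_{n\to\infty}\mathbb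 P\bigl(\hat F_n\models\varphi\bigr)=1\Bigr\} \] be the set of the formulas that are almost surely valid. Theorem. \(\mathbf{Grz.3}^{\mathbf{as}}=\mathbf{Grz.3}\). -/

import Mathlib

namespace RandomModal

/-! ### Modal formulas -/

/-- Formulas of the basic modal language with variables `p 0, p 1, …` and primitive
connectives `⊥`, `→`, `□`. -/
inductive Formula : Type
  | var : ℕ → Formula
  | bot : Formula
  | imp : Formula → Formula → Formula
  | box : Formula → Formula

namespace Formula

/-- Negation, `φ → ⊥`. -/
def neg (φ : Formula) : Formula := imp φ bot

/-- Disjunction, `¬ φ → ψ`. -/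
def or (φ ψ : Formula) : Formula := imp (neg φ) ψ

/-- `φ.subst p θ` is `φ` with every occurrence of the variable `p` replaced by `θ`. -/
def subst (p : ℕ) (θ : Formula) : Formula → Formula
  | var q => if q = p then θ else var q
  | bot => bot
  | imp φ ψ => imp (subst p θ φ) (subst p θ ψ)
  | box φ => box (subst p θ φ)

/-- Truth-table value of a formula, where the variables and the formulas of the form `□ φ` are
regarded as propositional atoms whose values are given by `v`. -/
def boolEval (v : Formula → Prop) : Formula → Prop
  | var q => v (var q)
  | bot => False
  | imp φ ψ => boolEval v φ → boolEval v ψ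
  | box φ => v (box φ)

/-- Propositional tautologies (in the modal language). -/
def IsTautology (φ : Formula) : Prop := ∀ v : Formula → Prop, boolEval v φ

/-- The normality axiom `□(p → q) → (□p → □q)`. -/
def axK : Formula :=
  imp (box (imp (var 0) (var 1))) (imp (box (var 0)) (box (var 1)))

/-- `□p → p`. -/
def axT : Formula := imp (box (var 0)) (var 0)

/-- `□p → □□p`. -/
def axFour : Formula := imp (box (var 0)) (box (box (var 0)))

/-- Linearity axiom `□(□p → q) ∨ □(□q → p)`. -/
def axThree : Formula :=
  or (box (imp (box (var 0)) (var 1))) (box (imp (box (var 1)) (var 0)))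

/-- Grzegorczyk's axiom `□(□(p → □p) → p) → p`. -/
def axGrz : Formula :=
  imp (box (imp (box (imp (var 0) (box (var 0)))) (var 0))) (var 0)

end Formula

open Formula

/-! ### Normal modal logics -/

/-- `L` is a normal modal logic. -/
structure IsNormalLogic (L : Set Formula) : Prop where
  taut : ∀ φ, IsTautology φ → φ ∈ L
  axK_mem : axK ∈ L
  mp : ∀ φ ψ, φ ∈ L → imp φ ψ ∈ L → ψ ∈ L
  gen : ∀ φ, φ ∈ L → box φ ∈ L
  sub : ∀ φ p θ, φ ∈ L → subst p θ φ ∈ L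

/-- The smallest normal modal logic that contains `Γ`. -/
def normalClosure (Γ : Set Formula) : Set Formula :=
  {φ | ∀ L : Set Formula, IsNormalLogic L → Γ ⊆ L → φ ∈ L}

/-- The logic `Grz.3`, that is `S4.3` extended with Grzegorczyk's axiom. -/
def Grz3 : Set Formula := normalClosure {axT, axFour, axThree, axGrz}

/-! ### Kripke frames and validity -/

/-- A Kripke frame: a nonempty set of states with a binary relation. -/
structure Frame : Type 1 where
  State : Type
  nonempty : Nonempty State
  rel : State → State → Prop

namespace Frame

/-- Truth of a formula at a state `x` of `F` under the valuation `V`. -/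
def Sat (F : Frame) (V : ℕ → F.State → Prop) : F.State → Formula → Prop
  | x, var q => V q x
  | _, bot => False
  | x, imp φ ψ => F.Sat V x φ → F.Sat V x ψ
  | x, box φ => ∀ y, F.rel x y → F.Sat V y φ

/-- `F ⊨ φ`: truth at every state under every valuation. -/
def Valid (F : Frame) (φ : Formula) : Prop := ∀ V x, F.Sat V x φ

/-- The frame with the states `0, …, n` (so with `n + 1` states) and the relation `R`. -/
def ofRel {n : ℕ} (R : Fin (n + 1) → Fin (n + 1) → Prop) : Frame where
  State := Fin (n + 1)
  nonempty := inferInstance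
  rel := R

end Frame

/-- `Fr Γ`: the class of all frames in which every formula of `Γ` is valid. -/
def Fr (Γ : Set Formula) : Set Frame := {F | ∀ φ ∈ Γ, F.Valid φ}

/-! ### Random frames -/

/-- The labelled frames with `n + 1` states that belong to the class `C`. -/
def labelled (C : Set Frame) (n : ℕ) : Set (Fin (n + 1) → Fin (n + 1) → Prop) :=
  {R | Frame.ofRel R ∈ C}

/-- The law of the random frame with `n + 1` states of the class `C`: the uniform distribution on
the finite set of the labelled frames with `n + 1` states that belong to `C`. -/
noncomputable def randomFrame (C : Set Frame) (n : ℕ) :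
    MeasureTheory.Measure (Fin (n + 1) → Fin (n + 1) → Prop) :=
  ProbabilityTheory.uniformOn (labelled C n)

/-- Every event has the probability `|labelled frames in C and A| / |labelled frames in C|`. -/
theorem randomFrame_apply (C : Set Frame) (n : ℕ)
    (A : Set (Fin (n + 1) → Fin (n + 1) → Prop)) :
    randomFrame C n A = ((labelled C n ∩ A).ncard : ENNReal) / ((labelled C n).ncard : ENNReal) := by
  have h : ∀ s : Set (Fin (n + 1) → Fin (n + 1) → Prop),
      MeasureTheory.Measure.count s = (s.ncard : ENNReal) := by
    intro s
    rw [MeasureTheory.Measure.count_apply s.toFinite.measurableSet, ← s.toFinite.cast_ncard_eq]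
    rfl
  rw [randomFrame, ProbabilityTheory.uniformOn,
    ProbabilityTheory.cond_apply (labelled C n).toFinite.measurableSet, h, h,
    ENNReal.div_eq_inv_mul]

/-- The almost sure validities of the class `C`: the formulas that are valid in the random frame
of `C` with probability tending to `1` as the number of states tends to infinity. -/
def LogAS (C : Set Frame) : Set Formula :=
  {φ | Filter.Tendsto (fun n : ℕ => randomFrame C n {R | (Frame.ofRel R).Valid φ})
    Filter.atTop (nhds 1)}

/-- `L^as`: the almost sure validities of the class of all frames of `L`. -/
def almostSure (L : Set Formula) : Set Formula := LogAS (Fr L)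

/-! ### The frames of `Grz.3` -/

/-- Non-branching relation. -/
def NonBranching {X : Type} (R : X → X → Prop) : Prop :=
  ∀ a b c, R a b → R a c → R b c ∨ R c b ∨ c = b

/-- Noetherian relation: no infinite chain `a 0 R a 1 R …` with `a i ≠ a (i + 1)`. -/
def Noetherian {X : Type} (R : X → X → Prop) : Prop :=
  ¬ ∃ a : ℕ → X, ∀ i, R (a i) (a (i + 1)) ∧ a i ≠ a (i + 1)

theorem sat_subst (F : Frame) (V : ℕ → F.State → Prop) (p : ℕ) (θ : Formula) (φ : Formula) :
    ∀ x, F.Sat V x (subst p θ φ) ↔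
      F.Sat (fun q y => if q = p then F.Sat V y θ else V q y) x φ := by
  induction φ with
  | var q => intro x; by_cases h : q = p <;> simp [subst, Frame.Sat, h]
  | bot => intro x; exact Iff.rfl
  | imp φ ψ h₁ h₂ => intro x; simp only [subst, Frame.Sat, h₁, h₂]
  | box φ h => intro x; simp only [subst, Frame.Sat, h]

theorem isNormalLogic_valid (F : Frame) : IsNormalLogic {φ | F.Valid φ} where
  taut φ h V x := by
    have key : ∀ ψ, boolEval (F.Sat V x) ψ ↔ F.Sat V x ψ := by
      intro ψ
      induction ψ with
      | var q => exact Iff.rfl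
      | bot => exact Iff.rfl
      | imp φ ψ h₁ h₂ => simp only [boolEval, Frame.Sat, h₁, h₂]
      | box φ => exact Iff.rfl
    exact (key φ).1 (h _)
  axK_mem V x h₁ h₂ y hy := h₁ y hy (h₂ y hy)
  mp φ ψ h₁ h₂ V x := h₂ V x (h₁ V x)
  gen φ h V x y _ := h V y
  sub φ p θ h V x := (sat_subst F V p θ φ x).2 (h _ x)

/-- The frames of `Grz.3` are the reflexive transitive non-branching Noetherian frames. -/
theorem mem_Fr_Grz3_iff (F : Frame) :
    F ∈ Fr Grz3 ↔ (∀ a, F.rel a a) ∧ (∀ a b c, F.rel a b → F.rel b c → F.rel a c) ∧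
      NonBranching F.rel ∧ Noetherian F.rel := by
  constructor
  · intro hF
    have hax : ∀ φ ∈ ({axT, axFour, axThree, axGrz} : Set Formula), F.Valid φ :=
      fun φ hφ => hF φ fun L _ hL => hL hφ
    have hT : F.Valid axT := hax _ (by simp)
    have h4 : F.Valid axFour := hax _ (by simp)
    have h3 : F.Valid axThree := hax _ (by simp)
    have hG : F.Valid axGrz := hax _ (by simp)
    have hrefl : ∀ a, F.rel a a := fun a => hT (fun _ y => F.rel a y) a (fun _ h => h)
    have htrans : ∀ a b c, F.rel a b → F.rel b c → F.rel a c := fun a b c hb hc =>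
      h4 (fun _ y => F.rel a y) a (fun _ h => h) b hb c hc
    refine ⟨hrefl, htrans, ?_, ?_⟩
    · intro a b c hb hc
      by_contra hcon
      push Not at hcon
      have := h3 (fun q y => if q = 0 then F.rel b y else F.rel c y) a
      simp only [axThree, Formula.or, Formula.neg, Frame.Sat] at this
      have h' := this
        (fun h => hcon.2.1 (by simpa using h b hb (fun y hy => by simpa using hy)))
        c hc (fun y hy => by simpa using hy)
      exact hcon.1 (by simpa using h')
    · rintro ⟨a, ha⟩
      have hanti : ∀ x y, F.rel x y → F.rel y x → x = y := by
        intro x y hxy hyx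
        by_contra hne
        refine hG (fun _ z => z ≠ x) x ?_ rfl
        intro z _ hbox hz
        subst hz
        exact hbox y hxy (fun h => hne h.symm) z hyx rfl
      have hmono : ∀ k i, F.rel (a i) (a (i + k)) := by
        intro k i
        induction k with
        | zero => exact hrefl _
        | succ k ih => exact htrans _ _ _ ih (ha (i + k)).1
      have hle : ∀ i j, i ≤ j → F.rel (a i) (a j) := by
        intro i j hij
        obtain ⟨k, rfl⟩ := Nat.exists_eq_add_of_le hij
        exact hmono k i
      have hinj : ∀ i j, i < j → a i ≠ a j := by
        intro i j hij h
        refine (ha i).2 (hanti _ _ (ha i).1 ?_)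
        rw [h]
        exact hle _ _ hij
      refine hG (fun _ z => ∀ k, z ≠ a (2 * k)) (a 0) ?_ 0 rfl
      intro z _ hbox k hz
      subst hz
      refine hbox (a (2 * k + 1)) (ha _).1 ?_ (a (2 * k + 1 + 1)) (ha _).1 (k + 1) rfl
      intro m hm
      rcases lt_trichotomy (2 * k + 1) (2 * m) with h | h | h
      · exact hinj _ _ h hm
      · omega
      · exact hinj _ _ h hm.symm
  · rintro ⟨hrefl, htrans, hnb, hnoeth⟩ φ hφ
    refine hφ _ (isNormalLogic_valid F) ?_
    rintro ψ (rfl | rfl | rfl | rfl)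
    · exact fun V x h => h x (hrefl x)
    · exact fun V x h y hy z hz => h z (htrans _ _ _ hy hz)
    · intro V x
      simp only [axThree, Formula.or, Formula.neg, Frame.Sat]
      intro h c hc hq
      by_contra hp
      refine h fun b hb hb' => ?_
      rcases hnb x b c hb hc with h1 | h1 | rfl
      · exact absurd (hb' c h1) hp
      · exact hq b h1
      · exact absurd (hb' c (hrefl c)) hp
    · intro V x
      simp only [axGrz, Frame.Sat]
      intro h
      by_contra hx
      have step : ∀ z : {z // F.rel x z ∧ ¬ V 0 z}, ∃ u : F.State,
          ∃ v : {z // F.rel x z ∧ ¬ V 0 z}, F.rel z u ∧ F.rel u v ∧ V 0 u := by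
        rintro ⟨z, hz, hzp⟩
        have : ¬ ∀ y, F.rel z y → V 0 y → ∀ w, F.rel y w → V 0 w := fun hh => hzp (h z hz hh)
        push Not at this
        obtain ⟨u, hu, hup, v, hv, hvp⟩ := this
        exact ⟨u, ⟨v, htrans _ _ _ hz (htrans _ _ _ hu hv), hvp⟩, hu, hv, hup⟩
      choose u v huv using step
      let s : ℕ → {z // F.rel x z ∧ ¬ V 0 z} := fun n => v^[n] ⟨x, hrefl x, hx⟩
      have hs : ∀ n, s (n + 1) = v (s n) := fun n => Function.iterate_succ_apply' v n _
      refine hnoeth ⟨fun i => if i % 2 = 0 then (s (i / 2) : F.State) else u (s (i / 2)), ?_⟩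
      intro i
      rcases Nat.even_or_odd' i with ⟨k, rfl | rfl⟩
      · have e1 : (2 * k) % 2 = 0 := by omega
        have e2 : (2 * k + 1) % 2 ≠ 0 := by omega
        have e3 : (2 * k) / 2 = k := by omega
        have e4 : (2 * k + 1) / 2 = k := by omega
        simp only [e1, e2, e3, e4, if_true, if_false]
        refine ⟨(huv _).1, fun he => (s k).2.2 ?_⟩
        rw [he]
        exact (huv _).2.2
      · have e1 : (2 * k + 1 + 1) % 2 = 0 := by omega
        have e2 : (2 * k + 1) % 2 ≠ 0 := by omega
        have e3 : (2 * k + 1 + 1) / 2 = k + 1 := by omega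
        have e4 : (2 * k + 1) / 2 = k := by omega
        simp only [e1, e2, e3, e4, if_true, if_false, hs]
        refine ⟨(huv _).2.1, fun he => (v (s k)).2.2 ?_⟩
        rw [← he]
        exact (huv _).2.2

end RandomModal

namespace RandomModal

open Formula Filter

/-! ### Propositional compactness -/

/-- The iterated implication `θ₁ → ⋯ → θₖ → ψ`. -/
def impList (l : List Formula) (ψ : Formula) : Formula := l.foldr imp ψ

theorem boolEval_impList (v : Formula → Prop) (l : List Formula) (ψ : Formula) :
    boolEval v (impList l ψ) ↔ ((∀ θ ∈ l, boolEval v θ) → boolEval v ψ) := by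
  induction l with
  | nil => simp [impList]
  | cons a l ih =>
    have : boolEval v (impList (a :: l) ψ) ↔ (boolEval v a → boolEval v (impList l ψ)) := Iff.rfl
    rw [this, ih]
    simp

theorem boolEval_ultrafilter {ι : Type*} (U : Ultrafilter ι) (v : ι → Formula → Prop)
    (φ : Formula) : boolEval (fun ψ => ∀ᶠ i in U, v i ψ) φ ↔ ∀ᶠ i in U, boolEval (v i) φ := by
  induction φ with
  | var q => exact Iff.rfl
  | bot => exact eventually_const.symm
  | imp φ ψ h₁ h₂ => simp only [boolEval, h₁, h₂, Ultrafilter.eventually_imp]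
  | box φ => exact Iff.rfl

theorem exists_boolEval_of_finite (Γ : Set Formula)
    (h : ∀ s : Finset Formula, (s : Set Formula) ⊆ Γ → ∃ v, ∀ θ ∈ s, boolEval v θ) :
    ∃ v, ∀ θ ∈ Γ, boolEval v θ := by
  classical
  choose v hv using fun s : {s : Finset Formula // (s : Set Formula) ⊆ Γ} => h s.1 s.2
  have : Nonempty {s : Finset Formula // (s : Set Formula) ⊆ Γ} := ⟨⟨∅, by simp⟩⟩
  have : IsDirectedOrder {s : Finset Formula // (s : Set Formula) ⊆ Γ} :=
    ⟨fun a b => ⟨⟨a.1 ∪ b.1, by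
      rw [Finset.coe_union]; exact Set.union_subset a.2 b.2⟩,
      Finset.subset_union_left (s₁ := a.1), Finset.subset_union_right (s₁ := a.1)⟩⟩
  let U : Ultrafilter {s : Finset Formula // (s : Set Formula) ⊆ Γ} := Ultrafilter.of atTop
  refine ⟨fun ψ => ∀ᶠ i in U, v i ψ, fun θ hθ => (boolEval_ultrafilter U v θ).2 ?_⟩
  have hev := eventually_ge_atTop
    (⟨{θ}, by simpa using hθ⟩ : {s : Finset Formula // (s : Set Formula) ⊆ Γ})
  filter_upwards [Ultrafilter.of_le _ hev] with s hs
  exact hv s θ (hs (Finset.mem_singleton_self θ))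

/-- A formula outside a set that contains the tautologies and is closed under modus ponens is
refuted by a Boolean valuation that satisfies the set. -/
theorem exists_boolEval_of_notMem {Δ : Set Formula} (ht : ∀ φ, IsTautology φ → φ ∈ Δ)
    (hmp : ∀ φ ψ, φ ∈ Δ → imp φ ψ ∈ Δ → ψ ∈ Δ) {ψ : Formula} (hψ : ψ ∉ Δ) :
    ∃ v, (∀ θ ∈ Δ, boolEval v θ) ∧ ¬ boolEval v ψ := by
  classical
  have hlist : ∀ l : List Formula, (∀ θ ∈ l, θ ∈ Δ) → impList l ψ ∉ Δ := by
    intro l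
    induction l with
    | nil => intro _; exact hψ
    | cons a l ih =>
      intro hl hmem
      exact ih (fun θ hθ => hl θ (by simp [hθ])) (hmp a _ (hl a (by simp)) hmem)
  obtain ⟨v, hv⟩ := exists_boolEval_of_finite (insert (neg ψ) Δ) (by
    intro s hs
    by_contra hcon
    push Not at hcon
    refine hlist (s.erase (neg ψ)).toList ?_ (ht _ ?_)
    · intro θ hθ
      simp only [Finset.mem_toList, Finset.mem_erase] at hθ
      exact (hs hθ.2).resolve_left hθ.1
    · intro v
      rw [boolEval_impList]
      intro hall
      by_contra hn
      obtain ⟨θ, hθ, hθv⟩ := hcon v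
      by_cases he : θ = neg ψ
      · subst he
        exact hθv hn
      · exact hθv (hall θ (by simp [he, hθ])))
  exact ⟨v, fun θ hθ => hv θ (Set.mem_insert_of_mem _ hθ), hv _ (Set.mem_insert _ _)⟩

/-! ### Instances of axioms -/

theorem exists_fresh (φ : Formula) : ∃ N, ∀ k ≥ N, ∀ θ, subst k θ φ = φ := by
  induction φ with
  | var q => exact ⟨q + 1, fun k hk θ => by simp [subst]; omega⟩
  | bot => exact ⟨0, fun _ _ _ => rfl⟩
  | imp φ ψ h₁ h₂ =>
    obtain ⟨N, hN⟩ := h₁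
    obtain ⟨M, hM⟩ := h₂
    exact ⟨max N M, fun k hk θ => by
      simp [subst, hN k (le_trans (le_max_left _ _) hk), hM k (le_trans (le_max_right _ _) hk)]⟩
  | box φ h =>
    obtain ⟨N, hN⟩ := h
    exact ⟨N, fun k hk θ => by simp [subst, hN k hk]⟩

namespace IsNormalLogic

variable {L : Set Formula}

theorem axK_inst (hL : IsNormalLogic L) (ψ χ : Formula) :
    imp (box (imp ψ χ)) (imp (box ψ) (box χ)) ∈ L := by
  obtain ⟨N, hN⟩ := exists_fresh ψ
  have h := hL.sub _ (N + 2) χ (hL.sub _ 0 ψ (hL.sub _ 1 (var (N + 2)) hL.axK_mem))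
  simpa [axK, subst, hN (N + 2) (by omega)] using h

theorem axThree_inst (hL : IsNormalLogic L) (h3 : axThree ∈ L) (ψ χ : Formula) :
    Formula.or (box (imp (box ψ) χ)) (box (imp (box χ) ψ)) ∈ L := by
  obtain ⟨N, hN⟩ := exists_fresh ψ
  have h := hL.sub _ (N + 2) χ (hL.sub _ 0 ψ (hL.sub _ 1 (var (N + 2)) h3))
  simpa [axThree, Formula.or, Formula.neg, subst, hN (N + 2) (by omega)] using h

theorem axT_inst (hL : IsNormalLogic L) (h : axT ∈ L) (ψ : Formula) : imp (box ψ) ψ ∈ L := by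
  simpa [axT, subst] using hL.sub _ 0 ψ h

theorem axFour_inst (hL : IsNormalLogic L) (h : axFour ∈ L) (ψ : Formula) :
    imp (box ψ) (box (box ψ)) ∈ L := by
  simpa [axFour, subst] using hL.sub _ 0 ψ h

theorem axGrz_inst (hL : IsNormalLogic L) (h : axGrz ∈ L) (ψ : Formula) :
    imp (box (imp (box (imp ψ (box ψ))) ψ)) ψ ∈ L := by
  simpa [axGrz, subst] using hL.sub _ 0 ψ h

end IsNormalLogic

theorem isNormalLogic_normalClosure (Γ : Set Formula) : IsNormalLogic (normalClosure Γ) where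
  taut φ h _ hL _ := hL.taut φ h
  axK_mem _ hL _ := hL.axK_mem
  mp φ ψ h₁ h₂ L hL hΓ := hL.mp φ ψ (h₁ L hL hΓ) (h₂ L hL hΓ)
  gen φ h L hL hΓ := hL.gen φ (h L hL hΓ)
  sub φ p θ h L hL hΓ := hL.sub φ p θ (h L hL hΓ)

theorem subset_normalClosure (Γ : Set Formula) : Γ ⊆ normalClosure Γ :=
  fun _ hφ _ _ hΓ => hΓ hφ

/-! ### The canonical model -/

/-- A Boolean valuation of the modal language that satisfies `L`, in other words a maximal
`L`-consistent set. -/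
def World (L : Set Formula) : Type := {v : Formula → Prop // ∀ θ ∈ L, boolEval v θ}

namespace World

variable {L : Set Formula}

/-- `φ` belongs to the world `x`. -/
def Holds (x : World L) (φ : Formula) : Prop := boolEval x.1 φ

/-- The canonical accessibility relation. -/
def Rel (x y : World L) : Prop := ∀ ψ, x.Holds (box ψ) → y.Holds ψ

theorem holds_of_mem (x : World L) {φ : Formula} (h : φ ∈ L) : x.Holds φ := x.2 φ h

theorem exists_of_notMem (hL : IsNormalLogic L) {φ : Formula} (h : φ ∉ L) :
    ∃ x : World L, ¬ x.Holds φ := by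
  obtain ⟨v, hv, hφ⟩ := exists_boolEval_of_notMem hL.taut hL.mp h
  exact ⟨⟨v, hv⟩, hφ⟩

theorem exists_rel (hL : IsNormalLogic L) (x : World L) {ψ : Formula} (h : ¬ x.Holds (box ψ)) :
    ∃ y, x.Rel y ∧ ¬ y.Holds ψ := by
  have hmem : ∀ φ ∈ L, x.Holds (box φ) := fun φ hφ => x.holds_of_mem (hL.gen φ hφ)
  obtain ⟨v, hv, hψ⟩ := exists_boolEval_of_notMem (Δ := {χ | x.Holds (box χ)})
    (fun φ hφ => hmem φ (hL.taut φ hφ))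
    (fun φ χ h₁ h₂ => x.holds_of_mem (hL.axK_inst φ χ) h₂ h₁) h
  exact ⟨⟨v, fun θ hθ => hv θ (hmem θ hθ)⟩, fun χ hχ => hv χ hχ, hψ⟩

theorem rel_refl (hL : IsNormalLogic L) (hT : axT ∈ L) (x : World L) : x.Rel x :=
  fun ψ h => x.holds_of_mem (hL.axT_inst hT ψ) h

theorem rel_trans (hL : IsNormalLogic L) (h4 : axFour ∈ L) {x y z : World L} (hxy : x.Rel y)
    (hyz : y.Rel z) : x.Rel z :=
  fun ψ h => hyz ψ (hxy (box ψ) (x.holds_of_mem (hL.axFour_inst h4 ψ) h))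

theorem rel_connected (hL : IsNormalLogic L) (h3 : axThree ∈ L) {x y z : World L}
    (hxy : x.Rel y) (hxz : x.Rel z) : y.Rel z ∨ z.Rel y := by
  by_contra hcon
  simp only [Rel] at hcon
  push Not at hcon
  obtain ⟨⟨ψ, hψ, hψ'⟩, χ, hχ, hχ'⟩ := hcon
  by_cases h : x.Holds (box (imp (box ψ) χ))
  · exact hχ' (hxy _ h hψ)
  · exact hψ' (hxz _ (x.holds_of_mem (hL.axThree_inst h3 ψ χ) h) hχ)

/-- In a logic with Grzegorczyk's axiom, a failure of `□ψ` has a final witness: above it `ψ` never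
fails again after it has been true. -/
theorem exists_final (hL : IsNormalLogic L) (h4 : axFour ∈ L) (hG : axGrz ∈ L) (x : World L)
    {ψ : Formula} (h : ¬ x.Holds (box ψ)) :
    ∃ y, x.Rel y ∧ ¬ y.Holds ψ ∧ ∀ z, y.Rel z → ¬ z.Holds (box ψ) → ¬ z.Holds ψ := by
  obtain ⟨y, hxy, hy⟩ := x.exists_rel hL h
  obtain ⟨z, hyz, hz⟩ := y.exists_rel hL
    (ψ := imp (box (imp ψ (box ψ))) ψ) fun h' => hy (y.holds_of_mem (hL.axGrz_inst hG ψ) h')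
  have hz' : z.Holds (box (imp ψ (box ψ))) ∧ ¬ z.Holds ψ := by
    simpa [Holds, boolEval] using hz
  exact ⟨z, rel_trans hL h4 hxy hyz, hz'.2, fun w hzw hw hw' => hw (hzw _ hz'.1 hw')⟩

end World

/-! ### Completeness with respect to finite chains -/

/-- The list of the formulas `ψ` such that `□ψ` is a subformula of the given formula. -/
def Formula.boxed : Formula → List Formula
  | var _ => []
  | bot => []
  | imp φ ψ => boxed φ ++ boxed ψ
  | box φ => φ :: boxed φ

/-- The chain `0 < ⋯ < m` as a reflexive frame. -/
def chain (m : ℕ) : Frame := Frame.ofRel fun i j : Fin (m + 1) => i ≤ j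

theorem exists_pairwise_list {α : Type*} (r : α → α → Prop) (s : List α)
    (htrans : ∀ a b c, r a b → r b c → r a c)
    (htotal : ∀ a ∈ s, ∀ b ∈ s, r a b ∨ r b a) :
    ∃ l : List α, l.Pairwise r ∧ ∀ a, a ∈ l ↔ a ∈ s := by
  classical
  let r' : {a // a ∈ s} → {a // a ∈ s} → Prop := fun a b => r a b
  have : IsTrans _ r' := ⟨fun a b c => htrans a b c⟩
  have : Std.Total r' := ⟨fun a b => htotal a a.2 b b.2⟩
  refine ⟨(s.attach.insertionSort r').map Subtype.val, ?_, fun a => ?_⟩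
  · rw [List.pairwise_map]
    exact List.pairwise_insertionSort r' _
  · simp [List.mem_insertionSort]

/-- `Grz.3` is complete with respect to finite chains. -/
theorem exists_chain_not_sat {φ : Formula} (hφ : φ ∉ Grz3) :
    ∃ (m : ℕ) (V : ℕ → Fin (m + 1) → Prop), ¬ (chain m).Sat V (0 : Fin (m + 1)) φ := by
  classical
  have hL : IsNormalLogic Grz3 := isNormalLogic_normalClosure _
  have hsub := subset_normalClosure {axT, axFour, axThree, axGrz}
  have hT : axT ∈ Grz3 := hsub (by simp)
  have h4 : axFour ∈ Grz3 := hsub (by simp)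
  have h3 : axThree ∈ Grz3 := hsub (by simp)
  have hG : axGrz ∈ Grz3 := hsub (by simp)
  obtain ⟨x, hx⟩ := World.exists_of_notMem hL hφ
  have hw : ∀ ψ, ∃ y, x.Rel y ∧ (¬ x.Holds (box ψ) → ¬ y.Holds ψ ∧
      ∀ z, y.Rel z → ¬ z.Holds (box ψ) → ¬ z.Holds ψ) := by
    intro ψ
    by_cases h : x.Holds (box ψ)
    · exact ⟨x, x.rel_refl hL hT, fun h' => absurd h h'⟩
    · obtain ⟨y, h₁, h₂⟩ := x.exists_final hL h4 hG h
      exact ⟨y, h₁, fun _ => h₂⟩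
  choose w hxw hw using hw
  obtain ⟨l, hl, hmem⟩ := exists_pairwise_list World.Rel (φ.boxed.map w)
    (fun a b c => World.rel_trans hL h4) (by
      intro a ha b hb
      obtain ⟨ψ, -, rfl⟩ := List.mem_map.1 ha
      obtain ⟨χ, -, rfl⟩ := List.mem_map.1 hb
      exact World.rel_connected hL h3 (hxw ψ) (hxw χ))
  have hxl : ∀ y ∈ l, x.Rel y := by
    intro y hy
    obtain ⟨ψ, -, rfl⟩ := List.mem_map.1 ((hmem y).1 hy)
    exact hxw ψ
  let p : Fin (l.length + 1) → World Grz3 := fun i => (x :: l).get i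
  have hpw : (x :: l).Pairwise World.Rel := List.pairwise_cons.2 ⟨hxl, hl⟩
  have hp : ∀ i j : Fin (l.length + 1), i ≤ j → (p i).Rel (p j) := by
    intro i j hij
    rcases hij.lt_or_eq with h | rfl
    · exact List.pairwise_iff_get.1 hpw i j h
    · exact World.rel_refl hL hT _
  refine ⟨l.length, fun q i => (p i).Holds (var q), fun hs => hx ?_⟩
  have key : ∀ ψ : Formula, ψ.boxed ⊆ φ.boxed → ∀ i : Fin (l.length + 1),
      (chain l.length).Sat (fun q i => (p i).Holds (var q)) i ψ ↔ (p i).Holds ψ := by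
    intro ψ
    induction ψ with
    | var q => intro _ i; exact Iff.rfl
    | bot => intro _ i; exact Iff.rfl
    | imp ψ χ h₁ h₂ =>
      intro h i
      exact imp_congr (h₁ (fun _ h' => h (List.mem_append_left _ h')) i)
        (h₂ (fun _ h' => h (List.mem_append_right _ h')) i)
    | box ψ ih =>
      intro h i
      replace ih := ih fun _ h' => h (List.mem_cons_of_mem _ h')
      constructor
      · intro hi
        by_contra hn
        have hxn : ¬ x.Holds (box ψ) := fun h' =>
          hn (hp 0 i (Fin.zero_le i) _ (x.holds_of_mem (hL.axFour_inst h4 ψ) h'))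
        have hwl : w ψ ∈ x :: l := List.mem_cons_of_mem _
          ((hmem _).2 (List.mem_map_of_mem (h (List.mem_cons_self))))
        obtain ⟨j, hj⟩ := List.mem_iff_get.1 hwl
        have hj : p j = w ψ := hj
        obtain ⟨hw₁, hw₂⟩ := hw ψ hxn
        rcases le_total i j with hij | hij
        · exact hw₁ (hj ▸ (ih j).1 (hi j hij))
        · exact hw₂ (p i) (hj ▸ hp j i hij) hn ((ih i).1 (hi i le_rfl))
      · intro hi j hij
        exact (ih j).2 (hp i j hij ψ hi)
  exact (key φ (fun _ h => h) 0).1 hs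

/-! ### Counting functions of bounded depth -/

section Counting

variable {α : Type} [DecidableEq α]

/-- The elements of `V` fall into `m` layers; `g` sends the first layer into `T` and each further
layer into the preceding one. -/
def Layered : ℕ → Finset α → Finset (Option α) → (α → Option α) → Prop
  | 0, V, _, _ => V = ∅
  | m + 1, V, T, g => ∃ S ⊆ V, (∀ x ∈ S, g x ∈ T) ∧
      Layered m (V \ S) (S.map Function.Embedding.some) g

theorem Layered.congr {m : ℕ} {V : Finset α} {T : Finset (Option α)} {g g' : α → Option α}
    (h : Layered m V T g) (he : ∀ x ∈ V, g x = g' x) : Layered m V T g' := by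
  induction m generalizing V T with
  | zero => exact h
  | succ m ih =>
    obtain ⟨S, hS, hT, h⟩ := h
    exact ⟨S, hS, fun x hx => he x (hS hx) ▸ hT x hx,
      ih h fun x hx => he x (Finset.mem_sdiff.1 hx).1⟩

theorem layered_of_rank {m : ℕ} {V : Finset α} {T : Finset (Option α)} {g : α → Option α}
    (r : α → ℕ) (hpos : ∀ x ∈ V, 0 < r x) (hle : ∀ x ∈ V, r x ≤ m)
    (hg : ∀ x ∈ V, g x ∈ T ∨ ∃ y ∈ V, g x = some y ∧ r y < r x) : Layered m V T g := by
  induction m generalizing V T r with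
  | zero =>
    refine Finset.eq_empty_of_forall_notMem fun x hx => ?_
    have := hpos x hx
    have := hle x hx
    omega
  | succ m ih =>
    refine ⟨V.filter fun x => g x ∈ T, Finset.filter_subset _ _,
      fun x hx => (Finset.mem_filter.1 hx).2, ih (fun x => r x - 1) ?_ ?_ ?_⟩
    all_goals
      intro x hx
      simp only [Finset.mem_sdiff, Finset.mem_filter, not_and] at hx
      obtain ⟨y, hy, hxy, hr⟩ := (hg x hx.1).resolve_left (hx.2 hx.1)
      have h₁ := hpos y hy
      have h₂ := hle x hx.1
    · omega
    · omega
    · by_cases hyT : g y ∈ T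
      · exact Or.inl (by simp [hxy, hy, hyT])
      · exact Or.inr ⟨y, by simp [hy, hyT], hxy, by omega⟩

/-- The functions on `V` that are layered over `T`, extended by `none` outside `V`. -/
def layeredMaps (m : ℕ) (V : Finset α) (T : Finset (Option α)) : Set (α → Option α) :=
  {g | (∀ x ∉ V, g x = none) ∧ Layered m V T g}

/-- The number of functions from a set with `n` elements that are layered over a set with `t`
elements, where at most `m` layers are allowed and the layers are part of the data. -/
def layeredCount : ℕ → ℕ → ℕ → ℕ
  | 0, n, _ => if n = 0 then 1 else 0
  | m + 1, n, t => ∑ k ∈ Finset.range (n + 1), n.choose k * (t ^ k * layeredCount m (n - k) k)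

theorem ncard_layeredMaps_le [Fintype α] (m : ℕ) (V : Finset α) (T : Finset (Option α)) :
    (layeredMaps m V T).ncard ≤ layeredCount m V.card T.card := by
  induction m generalizing V T with
  | zero =>
    rcases V.eq_empty_or_nonempty with rfl | hV
    · have : layeredMaps 0 (∅ : Finset α) T ⊆ {fun _ => none} := fun g hg =>
        funext fun x => hg.1 x (by simp)
      simpa [layeredCount] using Set.ncard_le_ncard this
    · have : layeredMaps 0 V T = ∅ :=
        Set.eq_empty_of_forall_notMem fun g hg => hV.ne_empty hg.2
      simp [this]
  | succ m ih =>
    let A : Finset α → Set (α → Option α) := fun S =>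
      {g | (∀ x ∉ V, g x = none) ∧ (∀ x ∈ S, g x ∈ T) ∧
        Layered m (V \ S) (S.map Function.Embedding.some) g}
    have hcover : layeredMaps (m + 1) V T ⊆ ⋃ S ∈ V.powerset, A S := by
      rintro g ⟨hg, S, hS, h⟩
      simp only [Set.mem_iUnion]
      exact ⟨S, Finset.mem_powerset.2 hS, hg, h⟩
    have hA : ∀ S ∈ V.powerset,
        (A S).ncard ≤ T.card ^ S.card * layeredCount m (V.card - S.card) S.card := by
      intro S hS
      have hS := Finset.mem_powerset.1 hS
      let P : Finset (α → Option α) := Fintype.piFinset fun x => if x ∈ S then T else {none}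
      have hP : P.card = T.card ^ S.card := by
        simp [P, apply_ite Finset.card]
      calc (A S).ncard
          ≤ ((P : Set (α → Option α)) ×ˢ
              layeredMaps m (V \ S) (S.map Function.Embedding.some)).ncard := by
            refine Set.ncard_le_ncard_of_injOn
              (fun g => (fun x => if x ∈ S then g x else none,
                fun x => if x ∈ S then none else g x)) ?_ ?_
            · rintro g ⟨h₁, h₂, h₃⟩
              refine ⟨?_, ?_, h₃.congr fun x hx => ?_⟩
              · simp only [P, Finset.mem_coe, Fintype.mem_piFinset]
                intro x
                by_cases hx : x ∈ S
                · simpa [hx] using h₂ x hx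
                · simp [hx]
              · intro x hx
                by_cases hxS : x ∈ S
                · simp [hxS]
                · simpa [hxS] using h₁ x fun hxV => hx (Finset.mem_sdiff.2 ⟨hxV, hxS⟩)
              · simp [(Finset.mem_sdiff.1 hx).2]
            · intro g _ g' _ he
              funext x
              have he₁ := congrFun (Prod.ext_iff.1 he).1 x
              have he₂ := congrFun (Prod.ext_iff.1 he).2 x
              by_cases hx : x ∈ S
              · simpa [hx] using he₁
              · simpa [hx] using he₂
        _ = T.card ^ S.card *
              (layeredMaps m (V \ S) (S.map Function.Embedding.some)).ncard := by
            rw [Set.ncard_prod, Set.ncard_coe_finset, hP]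
        _ ≤ _ := by
            refine Nat.mul_le_mul_left _ ((ih _ _).trans_eq ?_)
            rw [Finset.card_map, Finset.card_sdiff_of_subset hS]
    calc (layeredMaps (m + 1) V T).ncard
        ≤ (⋃ S ∈ V.powerset, A S).ncard := Set.ncard_le_ncard hcover
      _ ≤ ∑ S ∈ V.powerset, (A S).ncard := Finset.set_ncard_biUnion_le _ _
      _ ≤ ∑ S ∈ V.powerset, T.card ^ S.card * layeredCount m (V.card - S.card) S.card :=
          Finset.sum_le_sum hA
      _ = layeredCount (m + 1) V.card T.card := by
          rw [Finset.sum_powerset_apply_card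
            (fun k => T.card ^ k * layeredCount m (V.card - k) k)]
          simp [layeredCount]

end Counting

theorem layeredCount_le (m : ℕ) : ∃ c : ℝ, ∀ n t : ℕ,
    (layeredCount m n t : ℝ) * 2 ^ n ≤ n.factorial * Real.exp (c * t) := by
  induction m with
  | zero =>
    refine ⟨0, fun n t => ?_⟩
    rcases n with _ | n
    · simp [layeredCount]
    · simp only [layeredCount, Nat.succ_ne_zero, if_false, Nat.cast_zero, zero_mul]
      positivity
  | succ m ih =>
    obtain ⟨c, hc⟩ := ih
    refine ⟨2 * Real.exp c, fun n t => ?_⟩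
    have hterm : ∀ k ∈ Finset.range (n + 1),
        ((n.choose k * (t ^ k * layeredCount m (n - k) k) : ℕ) : ℝ) * 2 ^ n ≤
          n.factorial * ((2 * Real.exp c * t) ^ k / k.factorial) := by
      intro k hk
      have hk : k ≤ n := Nat.lt_succ_iff.1 (Finset.mem_range.1 hk)
      have h2 : (2 : ℝ) ^ n = 2 ^ k * 2 ^ (n - k) := by rw [← pow_add]; congr 1; omega
      have hfac : (n.choose k : ℝ) * (n - k).factorial = n.factorial / k.factorial := by
        rw [eq_div_iff (by positivity)]
        have := Nat.choose_mul_factorial_mul_factorial hk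
        rw [← this]
        push_cast
        ring
      calc ((n.choose k * (t ^ k * layeredCount m (n - k) k) : ℕ) : ℝ) * 2 ^ n
          = n.choose k * ((2 * t) ^ k * (layeredCount m (n - k) k * 2 ^ (n - k))) := by
            rw [h2]; push_cast; ring
        _ ≤ n.choose k * ((2 * t) ^ k * ((n - k).factorial * Real.exp (c * k))) := by
            exact mul_le_mul_of_nonneg_left
              (mul_le_mul_of_nonneg_left (hc _ _) (by positivity)) (by positivity)
        _ = (n.choose k * (n - k).factorial) * (2 * Real.exp c * t) ^ k := by
            rw [mul_comm c, Real.exp_nat_mul]; ring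
        _ = n.factorial * ((2 * Real.exp c * t) ^ k / k.factorial) := by
            rw [hfac]; ring
    calc (layeredCount (m + 1) n t : ℝ) * 2 ^ n
        = ∑ k ∈ Finset.range (n + 1),
            ((n.choose k * (t ^ k * layeredCount m (n - k) k) : ℕ) : ℝ) * 2 ^ n := by
          simp only [layeredCount]
          rw [Nat.cast_sum, Finset.sum_mul]
      _ ≤ ∑ k ∈ Finset.range (n + 1),
            n.factorial * ((2 * Real.exp c * t) ^ k / k.factorial) := Finset.sum_le_sum hterm
      _ ≤ n.factorial * Real.exp (2 * Real.exp c * t) := by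
          rw [← Finset.mul_sum]
          gcongr
          exact Real.sum_le_exp_of_nonneg (by positivity) _

/-! ### Finite forests -/

/-- A forest order: a partial order in which the elements above any given one form a chain. -/
structure IsForest {α : Type} (R : α → α → Prop) : Prop where
  refl : ∀ a, R a a
  trans : ∀ a b c, R a b → R b c → R a c
  antisymm : ∀ a b, R a b → R b a → a = b
  total : ∀ a b c, R a b → R a c → R b c ∨ R c b

theorem IsForest.of_mem_Fr {F : Frame} (h : F ∈ Fr Grz3) : IsForest F.rel := by
  obtain ⟨hr, ht, hn, hN⟩ := (mem_Fr_Grz3_iff F).1 h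
  refine ⟨hr, ht, fun a b hab hba => ?_, fun a b c hb hc => ?_⟩
  · by_contra hne
    refine hN ⟨fun i => if Even i then a else b, fun i => ?_⟩
    by_cases hi : Even i
    · simpa [hi, Nat.even_add_one] using ⟨hab, hne⟩
    · simpa [hi, Nat.even_add_one] using ⟨hba, Ne.symm hne⟩
  · rcases hn a b c hb hc with h | h | rfl
    · exact Or.inl h
    · exact Or.inr h
    · exact Or.inl (hr _)

section Height

variable {α : Type} [Fintype α]

/-- The number of elements above `x`, including `x`. -/
noncomputable def height (R : α → α → Prop) (x : α) : ℕ := {y | R x y}.ncard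

/-- `y` is the immediate successor of `x`. -/
def IsParent (R : α → α → Prop) (x y : α) : Prop :=
  R x y ∧ x ≠ y ∧ ∀ z, R x z → x ≠ z → R y z

namespace IsForest

variable {R : α → α → Prop}

theorem height_pos (hR : IsForest R) (x : α) : 0 < height R x :=
  (Set.ncard_pos).2 ⟨x, hR.refl x⟩

theorem height_le (hR : IsForest R) {x y : α} (h : R x y) : height R y ≤ height R x :=
  Set.ncard_le_ncard fun _ hz => hR.trans _ _ _ h hz

theorem height_parent (hR : IsForest R) {x y : α} (h : IsParent R x y) :
    height R x = height R y + 1 := by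
  have he : {z | R x z} = insert x {z | R y z} := by
    ext z
    constructor
    · intro hz
      by_cases hxz : x = z
      · exact Or.inl hxz.symm
      · exact Or.inr (h.2.2 z hz hxz)
    · rintro (rfl | hz)
      · exact hR.refl _
      · exact hR.trans _ _ _ h.1 hz
  rw [height, he, Set.ncard_insert_of_notMem]
  · rfl
  · exact fun hyx => h.2.1 (hR.antisymm _ _ h.1 hyx)

theorem exists_parent (hR : IsForest R) {x y : α} (hxy : R x y) (hne : x ≠ y) :
    ∃ p, IsParent R x p := by
  obtain ⟨p, ⟨hp, hxp⟩, hmax⟩ := Set.exists_max_image {z | R x z ∧ x ≠ z} (height R)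
    (Set.toFinite _) ⟨y, hxy, hne⟩
  refine ⟨p, hp, hxp, fun z hz hxz => ?_⟩
  rcases hR.total x p z hp hz with h | h
  · exact h
  · have heq : {w | R p w} = {w | R z w} :=
      Set.eq_of_subset_of_ncard_le (fun w hw => hR.trans _ _ _ h hw) (hmax z ⟨hz, hxz⟩)
    have : z ∈ {w | R p w} := heq ▸ hR.refl z
    exact this

theorem exists_height_eq (hR : IsForest R) (x : α) {c : ℕ} (hc : 0 < c) (hcx : c ≤ height R x) :
    ∃ y, R x y ∧ height R y = c := by
  obtain ⟨d, hd⟩ := Nat.exists_eq_add_of_le hcx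
  induction d generalizing x with
  | zero => exact ⟨x, hR.refl x, hd⟩
  | succ d ih =>
    have hlt : 1 < {y | R x y}.ncard := by
      change 1 < height R x
      omega
    obtain ⟨y, hy, hne⟩ := Set.exists_ne_of_one_lt_ncard hlt x
    obtain ⟨p, hp⟩ := hR.exists_parent hy hne.symm
    have := hR.height_parent hp
    obtain ⟨z, hz, hzc⟩ := ih p (by omega) (by omega)
    exact ⟨z, hR.trans _ _ _ hp.1 hz, hzc⟩

end IsForest

open Classical in
/-- The function that sends each element to its immediate successor. -/
noncomputable def parent (R : α → α → Prop) (x : α) : Option α :=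
  if h : ∃ y, IsParent R x y then some h.choose else none

theorem parent_eq_some {R : α → α → Prop} {x y : α} (h : parent R x = some y) :
    IsParent R x y := by
  unfold parent at h
  split_ifs at h with hx
  exact Option.some.inj h ▸ hx.choose_spec

theorem not_isParent_of_parent_eq_none {R : α → α → Prop} {x y : α} (h : parent R x = none) :
    ¬ IsParent R x y := by
  unfold parent at h
  split_ifs at h with hx
  exact fun hy => hx ⟨y, hy⟩

theorem IsForest.rel_iff {R : α → α → Prop} (hR : IsForest R) (x z : α) :
    R x z ↔ x = z ∨ ∃ y, parent R x = some y ∧ R y z := by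
  constructor
  · intro hz
    by_cases hxz : x = z
    · exact Or.inl hxz
    · obtain ⟨p, hp⟩ := hR.exists_parent hz hxz
      rcases hq : parent R x with _ | y
      · exact absurd hp (not_isParent_of_parent_eq_none hq)
      · exact Or.inr ⟨y, rfl, (parent_eq_some hq).2.2 z hz hxz⟩
  · rintro (rfl | ⟨y, hy, hz⟩)
    · exact hR.refl _
    · exact hR.trans _ _ _ (parent_eq_some hy).1 hz

theorem parent_injOn : Set.InjOn parent {R : α → α → Prop | IsForest R} := by
  intro R hR R' hR' he
  have key : ∀ n x, height R x ≤ n → ∀ z, R x z ↔ R' x z := by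
    intro n
    induction n with
    | zero => intro x hx; exact absurd (hR.height_pos x) (by omega)
    | succ n ih =>
      intro x hx z
      rw [hR.rel_iff, hR'.rel_iff, he]
      refine or_congr_right (exists_congr fun y => and_congr_right fun hy => ih y ?_ z)
      have := hR.height_parent (parent_eq_some (he ▸ hy))
      omega
  funext x z
  exact propext (key _ x le_rfl z)

theorem ncard_forests_le (m : ℕ) :
    {R : α → α → Prop | IsForest R ∧ ∀ x, height R x ≤ m}.ncard ≤
      layeredCount m (Fintype.card α) 1 := by
  classical
  refine le_trans (Set.ncard_le_ncard_of_injOn (t := layeredMaps m Finset.univ {none}) parent ?_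
    (parent_injOn.mono fun R hR => hR.1))
    ((ncard_layeredMaps_le m Finset.univ {none}).trans_eq (by simp))
  rintro R ⟨hR, hm⟩
  refine ⟨by simp, layered_of_rank (height R) (fun x _ => hR.height_pos x) (fun x _ => hm x)
    fun x _ => ?_⟩
  rcases hx : parent R x with _ | y
  · simp
  · exact Or.inr ⟨y, by simp, rfl, by rw [hR.height_parent (parent_eq_some hx)]; omega⟩

end Height

theorem mem_labelled_of_perm {n : ℕ} (σ : Equiv.Perm (Fin (n + 1))) :
    (fun x y => σ x ≤ σ y) ∈ labelled (Fr Grz3) n := by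
  refine (mem_Fr_Grz3_iff _).2 ⟨fun a => le_refl (σ a), fun a b c => le_trans, ?_, ?_⟩
  · intro a b c _ _
    exact (le_total (σ b) (σ c)).imp_right Or.inl
  · rintro ⟨a, ha⟩
    have hmono : StrictMono fun i => σ (a i) :=
      strictMono_nat_of_lt_succ fun i =>
        lt_of_le_of_ne (ha i).1 fun h => (ha i).2 (σ.injective h)
    exact not_injective_infinite_finite _ hmono.injective

theorem factorial_le_ncard_labelled (n : ℕ) :
    (n + 1).factorial ≤ (labelled (Fr Grz3) n).ncard := by
  have hinj : Function.Injective
      fun (σ : Equiv.Perm (Fin (n + 1))) (x y : Fin (n + 1)) => σ x ≤ σ y := by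
    intro σ τ h
    have h' : ∀ x y, σ x ≤ σ y ↔ τ x ≤ τ y := fun x y => iff_of_eq (congrFun (congrFun h x) y)
    let e : Fin (n + 1) ≃o Fin (n + 1) :=
      ⟨σ.symm.trans τ, fun {a b} => by simpa using (h' (σ.symm a) (σ.symm b)).symm⟩
    have he : e = OrderIso.refl _ := Subsingleton.elim _ _
    ext x
    have := DFunLike.congr_fun he (σ x)
    simpa [e] using congrArg Fin.val this.symm
  calc (n + 1).factorial
      = (Set.univ : Set (Equiv.Perm (Fin (n + 1)))).ncard := by
        rw [Set.ncard_univ, Nat.card_eq_fintype_card, Fintype.card_perm, Fintype.card_fin]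
    _ ≤ _ := Set.ncard_le_ncard_of_injOn _ (fun σ _ => mem_labelled_of_perm σ) hinj.injOn

/-- The random frame of `Grz.3` is almost surely higher than any given bound. -/
theorem tendsto_randomFrame_height_le (m : ℕ) :
    Tendsto (fun n => randomFrame (Fr Grz3) n {R | ∀ x, height R x ≤ m}) atTop (nhds 0) := by
  obtain ⟨c, hc⟩ := layeredCount_le m
  have hlim : Tendsto (fun n : ℕ => ENNReal.ofReal (Real.exp c * (1 / 2) ^ (n + 1))) atTop
      (nhds 0) := by
    rw [← ENNReal.ofReal_zero]
    refine ENNReal.tendsto_ofReal ?_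
    rw [← mul_zero (Real.exp c)]
    exact ((tendsto_pow_atTop_nhds_zero_of_lt_one (by norm_num) (by norm_num)).comp
      (tendsto_add_atTop_nat 1)).const_mul _
  refine tendsto_of_tendsto_of_tendsto_of_le_of_le tendsto_const_nhds hlim
    (fun _ => zero_le) fun n => ?_
  have hsub : labelled (Fr Grz3) n ∩ {R | ∀ x, height R x ≤ m} ⊆
      {R : Fin (n + 1) → Fin (n + 1) → Prop | IsForest R ∧ ∀ x, height R x ≤ m} :=
    fun R hR => ⟨IsForest.of_mem_Fr hR.1, hR.2⟩
  have hnum := (Set.ncard_le_ncard hsub).trans (ncard_forests_le m)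
  have hden := factorial_le_ncard_labelled n
  have hc := hc (n + 1) 1
  rw [Fintype.card_fin] at hnum
  have hfac : (0 : ℝ) < (n + 1).factorial := by positivity
  have hpos : (0 : ℝ) < ((labelled (Fr Grz3) n).ncard : ℝ) :=
    hfac.trans_le (by exact_mod_cast hden)
  rw [randomFrame_apply]
  dsimp only
  rw [← ENNReal.ofReal_natCast, ← ENNReal.ofReal_natCast, ← ENNReal.ofReal_div_of_pos hpos]
  refine ENNReal.ofReal_le_ofReal ?_
  rw [div_le_iff₀ hpos]
  calc ((labelled (Fr Grz3) n ∩ {R | ∀ x, height R x ≤ m}).ncard : ℝ)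
      ≤ layeredCount m (n + 1) 1 := by exact_mod_cast hnum
    _ = (layeredCount m (n + 1) 1 * 2 ^ (n + 1)) * (1 / 2) ^ (n + 1) := by
        rw [mul_assoc, ← mul_pow]; norm_num
    _ ≤ ((n + 1).factorial * Real.exp c) * (1 / 2) ^ (n + 1) := by
        exact mul_le_mul_of_nonneg_right (by simpa using hc) (by positivity)
    _ = Real.exp c * (1 / 2) ^ (n + 1) * (n + 1).factorial := by ring
    _ ≤ _ := by gcongr

/-! ### Refutation in high forests -/

/-- A forest with an element of height greater than `m` refutes what the chain `0 < ⋯ < m`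
refutes at its least element. -/
theorem height_le_of_valid {n m : ℕ} {R : Fin (n + 1) → Fin (n + 1) → Prop} (hR : IsForest R)
    {φ : Formula} (hφ : (Frame.ofRel R).Valid φ) {V : ℕ → Fin (m + 1) → Prop}
    (hV : ¬ (chain m).Sat V (0 : Fin (m + 1)) φ) (x : Fin (n + 1)) : height R x ≤ m := by
  by_contra hx
  let f : Fin (n + 1) → Fin (m + 1) := fun y =>
    ⟨m + 1 - height R y, by have := hR.height_pos y; omega⟩
  have key : ∀ (ψ : Formula) (y : Fin (n + 1)),
      (Frame.ofRel R).Sat (fun q z => V q (f z)) y ψ ↔ (chain m).Sat V (f y) ψ := by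
    intro ψ
    induction ψ with
    | var q => intro y; exact Iff.rfl
    | bot => intro y; exact Iff.rfl
    | imp ψ χ h₁ h₂ => intro y; exact imp_congr (h₁ y) (h₂ y)
    | box ψ ih =>
      intro y
      constructor
      · intro h (j : Fin (m + 1)) (hj : f y ≤ j)
        have hj' : m + 1 - height R y ≤ j := hj
        obtain ⟨z, hz, hzj⟩ := hR.exists_height_eq y (c := m + 1 - j) (by omega) (by omega)
        have hf : f z = j := Fin.ext (by simp only [f, hzj]; omega)
        exact hf ▸ (ih z).1 (h z hz)
      · intro h z hz
        refine (ih z).2 (h (f z) ?_)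
        have := hR.height_le hz
        change m + 1 - height R y ≤ m + 1 - height R z
        omega
  refine hV ?_
  have hf : f x = 0 := Fin.ext (by simp only [f, Fin.val_zero]; omega)
  exact hf ▸ (key φ x).1 (hφ _ x)

theorem Grz3_subset_almostSure : Grz3 ⊆ almostSure Grz3 := by
  intro φ hφ
  refine tendsto_const_nhds.congr fun n => ?_
  have hinter : labelled (Fr Grz3) n ∩ {R | (Frame.ofRel R).Valid φ} = labelled (Fr Grz3) n :=
    Set.inter_eq_left.2 fun R hR => hR φ hφ
  have hpos := (Nat.factorial_pos (n + 1)).trans_le (factorial_le_ncard_labelled n)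
  rw [randomFrame_apply, hinter, ENNReal.div_self (by exact_mod_cast hpos.ne')
    (ENNReal.natCast_ne_top _)]

theorem almostSure_Grz3_subset : almostSure Grz3 ⊆ Grz3 := by
  intro φ hφ
  by_contra hn
  obtain ⟨m, V, hV⟩ := exists_chain_not_sat hn
  have hzero : Tendsto (fun n => randomFrame (Fr Grz3) n {R | (Frame.ofRel R).Valid φ}) atTop
      (nhds 0) := by
    refine tendsto_of_tendsto_of_tendsto_of_le_of_le tendsto_const_nhds
      (tendsto_randomFrame_height_le m) (fun _ => zero_le) fun n => ?_
    dsimp only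
    rw [randomFrame_apply, randomFrame_apply]
    gcongr ?_ / _
    refine Nat.cast_le.2 (Set.ncard_le_ncard fun R hR => ⟨hR.1, fun x => ?_⟩)
    exact height_le_of_valid (IsForest.of_mem_Fr hR.1) hR.2 hV x
  exact zero_ne_one (tendsto_nhds_unique hzero hφ)

end RandomModal

/-- The almost sure validities of the finite frames of `Grz.3` form exactly `Grz.3`. -/
theorem theorem4p8 : RandomModal.almostSure RandomModal.Grz3 = RandomModal.Grz3 :=
  RandomModal.almostSure_Grz3_subset.antisymm RandomModal.Grz3_subset_almostSure
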